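/- Conventions. A signature $\Sigma$ is a set of symbols with finite arities; $\Sigma_\bot=\Sigma\uplus\{\bot\}$ with $\bot$ a fresh constant. A graph over $\Sigma$ consists of nodes, each labelled with a symbol of $\Sigma$ and carrying a finite sequence of successors whose length is the arity of the label; a term graph is a graph with a root from which all nodes are reachable. The positions of a node are the paths (finite sequences of edge numbers) from the root to it, its depth is the minimal length of its positions, and a term graph is canonical if each node is the set of its own positions. Each term graph is isomorphic to a unique canonical term graph, obtained by replacing each node by its set of positions. Order and metric. For canonical term graphs over $\Sigma_\bot$, $g\le_\bot h$ iff there is a root-preserving map from the nodes of $g$ to the nodes of $h$ that preserves labels and successors of all nodes not labelled $\bot$. The truncation $g{\dagger}d$ keeps the nodes of depth at most $d$, relabels those of depth $d$ by $\bot$ and removes their outgoing edges. For canonical term graphs over $\Sigma$, $d_\dagger(g,h)=0$ if $g=h$, and $d_\dagger(g,h)=2^{-d}$ with $d=\max\{e<\omega : g{\dagger}e\cong h{\dagger}e\}$ otherwise. The limit inferior of $(g_\iota)_{\iota<\alpha}$ is $\bigsqcup_{\beta<\alpha}\bigsqcap_{\beta\le\iota<\alpha}g_\iota$, taken with respect to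 $\le_\bot$. Rewriting. Fix a set $\mathcal V$ of nullary variables. A term graph rule over $\Sigma$ is a graph over $\Sigma\uplus\mathcal V$ with two nodes $l,r$ such that each node is reachable from $l$ or $r$, each variable labels at most one node, and each node labelled with a variable differs from $l$ and is reachable from $l$. A term graph rewriting system (GRS) $\mathcal R=(\Sigma,R)$ is a signature with a set $R$ of such rules; $\mathcal R_\bot=(\Sigma_\bot,R)$. A rule is applied to a term graph $g$ at a node $n$ as follows. Match the sub-term graph of the rule rooted in $l$ against the sub-term graph of $g$ rooted in $n$, by a homomorphism $\phi$ for which the conditions at variable nodes are suspended. Add to $g$ a copy of the nodes of the rule not reachable from $l$, with their edges, where edges to a node $m$ reachable from $l$ go to $\phi(m)$. Redirect all edges to $n$ (and the root pointer, if it is $n$) to the copy of $r$, or to $\phi(r)$ if $r$ is reachable from $l$. Finally remove all nodes not reachable from the root. A reduction step relates the canonical representatives of $g$ and of the result. A reduction of ordinal length $\alpha$ is a sequence of reduction steps $(g_\iota\to g_{\iota+1})_{\iota<\alpha}$; its underlying sequence of term graphs is $(g_\iota)_{\iota<\hat\alpha}$, where $\hat\alpha=\alpha$ if $\alpha$ is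 a limit ordinal and $\hat\alpha=\alpha+1$ otherwise. Convergence. A reduction $S$ in $\mathcal R$ weakly m-converges from $g$ to $h$ if $g_0=g$, $\lim_{\iota\to\lambda}g_\iota=g_\lambda$ with respect to $d_\dagger$ for each limit ordinal $\lambda<\alpha$, and $\lim_{\iota\to\hat\alpha}g_\iota=h$. A reduction $S$ in $\mathcal R_\bot$ weakly p-converges from $g$ to $h$ in $\mathcal R$ if $g_0=g$, $\liminf_{\iota\to\lambda}g_\iota=g_\lambda$ for each limit ordinal $\lambda<\alpha$, and $\liminf_{\iota\to\hat\alpha}g_\iota=h$. Theorem. (1) For every GRS $\mathcal R$ and every reduction $S$ in $\mathcal R$: if $S$ weakly m-converges from $g$ to $h$ in $\mathcal R$, then $S$ (regarded as a reduction in $\mathcal R_\bot$, which it is) weakly p-converges from $g$ to $h$ in $\mathcal R$. (2) The converse fails. Let $\Sigma$ have a binary symbol $f$ and a constant $c$; let $g_0$ be the canonical term graph of the tree $f(c,c)$ with two distinct $c$-nodes, and $g_1$ that of $f(c,c)$ with a single, shared $c$-node. Consider the GRS with the two rules $\rho_1,\rho_2$, each the disjoint union of its two sides, where both left-hand sides and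 the right-hand side of $\rho_1$ are the tree $g_0$ and the right-hand side of $\rho_2$ is $g_1$. This GRS has a reduction $g_0\to g_1\to g_0\to g_1\to\cdots$ of length $\omega$ that weakly p-converges from $g_0$ to the total term graph $g_0$, but does not weakly m-converge to any term graph. -/

import Mathlib

namespace TermGraphRewriting

universe u v w x y

/-! ### Signatures -/

/-- A signature: a set of symbols, each with a finite arity. -/
structure Signature where
  Sym : Type u
  arity : Sym → ℕ

/-- The signature `Σ_⊥ = Σ ⊎ {⊥}`; the fresh constant `⊥` is `none`. -/
def Signature.bot (Sg : Signature.{u}) : Signature.{u} where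
  Sym := Option Sg.Sym
  arity := fun s => s.elim 0 Sg.arity

/-- The signature `Σ_V = Σ ⊎ V`, where the variables in `V` are nullary. -/
def Signature.withVars (Sg : Signature.{u}) (V : Type w) : Signature.{max u w} where
  Sym := Sg.Sym ⊕ V
  arity := Sum.elim Sg.arity (fun _ => 0)

/-- The symbol `⊥` of `Σ_⊥`. -/
def Signature.botSym (Sg : Signature.{u}) : Sg.bot.Sym := (none : Option Sg.Sym)

/-- A symbol of `Σ` as a symbol of `Σ_⊥`. -/
def Signature.toBotSym (Sg : Signature.{u}) (s : Sg.Sym) : Sg.bot.Sym := some s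

/-- A symbol of `Σ` as a symbol of `Σ_V`. -/
def Signature.funSym (Sg : Signature.{u}) (V : Type w) (s : Sg.Sym) : (Sg.withVars V).Sym :=
  Sum.inl s

/-- A variable as a symbol of `Σ_V`. -/
def Signature.varSym (Sg : Signature.{u}) (V : Type w) (z : V) : (Sg.withVars V).Sym :=
  Sum.inr z

/-- The set of variables, as a set of constants of `Σ_V`. -/
def Signature.vars (Sg : Signature.{u}) (V : Type w) : Set (Sg.withVars V).Sym :=
  Set.range (Sg.varSym V)

/-! ### Paths -/

/-- `IsPath suc m π n`: following the edges numbered by `π` from `m` leads to `n`. -/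
def IsPath {N : Type v} (suc : N → List N) : N → List ℕ → N → Prop
  | m, [], n => m = n
  | m, i :: π, n => ∃ k, (suc m)[i]? = some k ∧ IsPath suc k π n

/-- `n` is reachable from `m`. -/
def Reach {N : Type v} (suc : N → List N) (m n : N) : Prop := ∃ π, IsPath suc m π n

theorem IsPath.append {N : Type v} {suc : N → List N} {π π' : List ℕ} :
    ∀ {m n k : N}, IsPath suc m π n → IsPath suc n π' k → IsPath suc m (π ++ π') k := by
  induction π with
  | nil => intro m n k h h'; cases h; exact h'
  | cons i π ih =>
    rintro m n k ⟨a, ha, hp⟩ h'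
    exact ⟨a, ha, ih hp h'⟩

theorem IsPath.unique {N : Type v} {suc : N → List N} {π : List ℕ} :
    ∀ {m n k : N}, IsPath suc m π n → IsPath suc m π k → n = k := by
  induction π with
  | nil => intro m n k h h'; exact h.symm.trans h'
  | cons i π ih =>
    rintro m n k ⟨a, ha, hp⟩ ⟨b, hb, hq⟩
    obtain rfl : a = b := Option.some.inj (ha.symm.trans hb)
    exact ih hp hq

theorem IsPath.map {N : Type v} {M : Type w} {suc : N → List N} {suc' : M → List M}
    {φ : N → M} (hφ : ∀ n, (suc n).map φ = suc' (φ n)) {π : List ℕ} :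
    ∀ {m n : N}, IsPath suc m π n → IsPath suc' (φ m) π (φ n) := by
  induction π with
  | nil => intro m n h; exact congrArg φ h
  | cons i π ih =>
    rintro m n ⟨a, ha, hp⟩
    refine ⟨φ a, ?_, ih hp⟩
    rw [← hφ, List.getElem?_map, ha]; rfl

theorem IsPath.lift {N : Type v} {M : Type w} {suc : N → List N} {suc' : M → List M}
    {φ : N → M} (hφ : ∀ n, (suc n).map φ = suc' (φ n)) {π : List ℕ} :
    ∀ {m : N} {k : M}, IsPath suc' (φ m) π k → ∃ n, φ n = k ∧ IsPath suc m π n := by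
  induction π with
  | nil => intro m k h; exact ⟨m, h, rfl⟩
  | cons i π ih =>
    rintro m k ⟨a, ha, hp⟩
    rw [← hφ, List.getElem?_map] at ha
    obtain ⟨b, hb, rfl⟩ := Option.map_eq_some_iff.1 ha
    obtain ⟨n, hn, hq⟩ := ih hp
    exact ⟨n, hn, b, hb, hq⟩

theorem Reach.step {N : Type v} {suc : N → List N} {m n k : N}
    (h : Reach suc m n) (hk : k ∈ suc n) : Reach suc m k := by
  obtain ⟨π, hπ⟩ := h
  obtain ⟨i, hi⟩ := List.mem_iff_getElem?.1 hk
  exact ⟨π ++ [i], hπ.append ⟨k, hi, rfl⟩⟩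

/-! ### Graphs and term graphs -/

/-- A graph over `Sg` with node set `N`. -/
structure Graph (Sg : Signature.{u}) (N : Type v) where
  lab : N → Sg.Sym
  suc : N → List N
  suc_length : ∀ n, (suc n).length = Sg.arity (lab n)

/-- A term graph over `Sg` with node set `N`: a graph all of whose nodes are reachable from
its root. -/
structure TermGraph (Sg : Signature.{u}) (N : Type v) extends Graph Sg N where
  root : N
  reachable : ∀ n, Reach suc root n

/-- Change of signature along an arity preserving map of symbols. -/
def Graph.relabel {Sg : Signature.{u}} {Sg' : Signature.{w}} {N : Type v} (g : Graph Sg N)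
    (f : Sg.Sym → Sg'.Sym) (hf : ∀ s, Sg'.arity (f s) = Sg.arity s) : Graph Sg' N where
  lab := fun n => f (g.lab n)
  suc := g.suc
  suc_length := fun n => (g.suc_length n).trans (hf _).symm

/-- Change of signature along an arity preserving map of symbols. -/
def TermGraph.relabel {Sg : Signature.{u}} {Sg' : Signature.{w}} {N : Type v}
    (g : TermGraph Sg N) (f : Sg.Sym → Sg'.Sym) (hf : ∀ s, Sg'.arity (f s) = Sg.arity s) :
    TermGraph Sg' N where
  toGraph := g.toGraph.relabel f hf
  root := g.root
  reachable := g.reachable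

/-- A (total) term graph over `Σ`, seen as a partial term graph, i.e. over `Σ_⊥`. -/
def TermGraph.toBot {Sg : Signature.{u}} {N : Type v} (g : TermGraph Sg N) :
    TermGraph Sg.bot N :=
  g.relabel Sg.toBotSym (fun _ => rfl)

/-- A term graph over `Σ`, seen as a term graph over `Σ_V`. -/
def TermGraph.withVars {Sg : Signature.{u}} {N : Type v} (g : TermGraph Sg N) (V : Type w) :
    TermGraph (Sg.withVars V) N :=
  g.relabel (Sg.funSym V) (fun _ => rfl)

/-- The set of positions of a node: the paths from the root to it. -/
def TermGraph.positions {Sg : Signature.{u}} {N : Type v} (g : TermGraph Sg N) (n : N) :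
    Set (List ℕ) :=
  {π | IsPath g.suc g.root π n}

/-- The depth of a node: the minimal length of its positions. -/
noncomputable def TermGraph.depth {Sg : Signature.{u}} {N : Type v} (g : TermGraph Sg N)
    (n : N) : ℕ :=
  sInf (List.length '' g.positions n)

/-- The sub-term graph rooted in the node `n`. -/
def Graph.sub {Sg : Signature.{u}} {N : Type v} (g : Graph Sg N) (n : N) :
    TermGraph Sg {m : N // Reach g.suc n m} where
  lab := fun m => g.lab m.1
  suc := fun m => (g.suc m.1).attachWith (Reach g.suc n) (fun _ hk => m.2.step hk)
  suc_length := fun m => by rw [List.length_attachWith]; exact g.suc_length m.1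
  root := ⟨n, [], rfl⟩
  reachable := by
    rintro ⟨m, π, hπ⟩
    obtain ⟨k, hk, hp⟩ := IsPath.lift (suc := fun m : {m : N // Reach g.suc n m} =>
      (g.suc m.1).attachWith (Reach g.suc n) (fun _ hk => m.2.step hk)) (suc' := g.suc)
      (φ := Subtype.val) (fun m => List.attachWith_map_subtype_val _)
      (m := ⟨n, [], rfl⟩) hπ
    obtain rfl : k = ⟨m, π, hπ⟩ := Subtype.ext hk
    exact ⟨π, hp⟩

/-! ### Homomorphisms -/

/-- `φ` is a `Δ`-homomorphism from `g` to `h`. (Used only for sets `Δ` of constants.) -/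
structure IsHom {Sg : Signature.{u}} (Δ : Set Sg.Sym) {N : Type v} {M : Type w}
    (g : TermGraph Sg N) (h : TermGraph Sg M) (φ : N → M) : Prop where
  map_root : φ g.root = h.root
  labelling : ∀ n, g.lab n ∉ Δ → g.lab n = h.lab (φ n)
  successor : ∀ n, g.lab n ∉ Δ → (g.suc n).map φ = h.suc (φ n)

/-- Isomorphism of term graphs. -/
def Iso {Sg : Signature.{u}} {N : Type v} {M : Type w}
    (g : TermGraph Sg N) (h : TermGraph Sg M) : Prop :=
  ∃ φ : N → M, Function.Bijective φ ∧ IsHom ∅ g h φ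

/-! ### Canonical term graphs -/

/-- A canonical term graph: each node is the set of its own positions. -/
structure CanTermGraph (Sg : Signature.{u}) where
  nodes : Set (Set (List ℕ))
  graph : TermGraph Sg nodes
  canonical : ∀ n : nodes, (n : Set (List ℕ)) = graph.positions n

/-- A canonical total term graph, seen as a canonical partial term graph. -/
def CanTermGraph.toBot {Sg : Signature.{u}} (g : CanTermGraph Sg) : CanTermGraph Sg.bot where
  nodes := g.nodes
  graph := g.graph.toBot
  canonical := g.canonical

theorem TermGraph.positions_injective {Sg : Signature.{u}} {N : Type v} (g : TermGraph Sg N) :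
    Function.Injective g.positions := by
  intro m n h
  obtain ⟨π, hπ⟩ := g.reachable m
  have h' : π ∈ g.positions n := h ▸ (show π ∈ g.positions m from hπ)
  exact IsPath.unique hπ h'

/-- Nodes correspond to their position sets. -/
noncomputable def TermGraph.posEquiv {Sg : Signature.{u}} {N : Type v} (g : TermGraph Sg N) :
    N ≃ Set.range g.positions :=
  Equiv.ofInjective g.positions g.positions_injective

/-- The successor function transported to position sets. -/
noncomputable def TermGraph.posSuc {Sg : Signature.{u}} {N : Type v} (g : TermGraph Sg N)
    (p : Set.range g.positions) : List (Set.range g.positions) :=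
  (g.suc (g.posEquiv.symm p)).map g.posEquiv

theorem TermGraph.posEquiv_suc {Sg : Signature.{u}} {N : Type v} (g : TermGraph Sg N) (n : N) :
    (g.suc n).map g.posEquiv = g.posSuc (g.posEquiv n) := by
  simp [TermGraph.posSuc]

/-- The canonical representative: every node is replaced by its set of positions. -/
noncomputable def canon {Sg : Signature.{u}} {N : Type v} (g : TermGraph Sg N) :
    CanTermGraph Sg where
  nodes := Set.range g.positions
  graph :=
    { lab := fun p => g.lab (g.posEquiv.symm p)
      suc := g.posSuc
      suc_length := fun p => by rw [TermGraph.posSuc, List.length_map]; exact g.suc_length _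
      root := g.posEquiv g.root
      reachable := fun p => by
        obtain ⟨n, rfl⟩ := g.posEquiv.surjective p
        obtain ⟨π, hπ⟩ := g.reachable n
        exact ⟨π, hπ.map g.posEquiv_suc⟩ }
  canonical := fun p => by
    obtain ⟨n, rfl⟩ := g.posEquiv.surjective p
    ext π
    constructor
    · intro h
      exact IsPath.map g.posEquiv_suc (show IsPath g.suc g.root π n from h)
    · intro h
      obtain ⟨k, hk, hp⟩ := IsPath.lift g.posEquiv_suc (m := g.root) (π := π) h
      obtain rfl : k = n := g.posEquiv.injective hk
      exact hp

/-! ### The partial order on canonical partial term graphs -/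

/-- `g ≤ h` iff there is a `⊥`-homomorphism from `g` to `h`. -/
instance instLE {Sg : Signature.{u}} : LE (CanTermGraph Sg.bot) where
  le g h := ∃ φ : g.nodes → h.nodes, IsHom {Sg.botSym} g.graph h.graph φ

/-! ### Truncation and the metric on canonical total term graphs -/

theorem TermGraph.depth_le {Sg : Signature.{u}} {N : Type v} (g : TermGraph Sg N) {n : N}
    {π : List ℕ} (h : IsPath g.suc g.root π n) : g.depth n ≤ π.length :=
  Nat.sInf_le ⟨π, h, rfl⟩

theorem TermGraph.exists_depth {Sg : Signature.{u}} {N : Type v} (g : TermGraph Sg N) (n : N) :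
    ∃ π, IsPath g.suc g.root π n ∧ π.length = g.depth n := by
  obtain ⟨π, hπ⟩ := g.reachable n
  exact Nat.sInf_mem (s := List.length '' g.positions n) ⟨_, π, hπ, rfl⟩

theorem TermGraph.depth_root {Sg : Signature.{u}} {N : Type v} (g : TermGraph Sg N) :
    g.depth g.root = 0 :=
  Nat.le_zero.1 (g.depth_le (π := []) rfl)

theorem TermGraph.depth_suc_le {Sg : Signature.{u}} {N : Type v} (g : TermGraph Sg N) {d : ℕ}
    {n k : N} (hn : g.depth n < d) (hk : k ∈ g.suc n) : g.depth k ≤ d := by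
  obtain ⟨π, hπ, hl⟩ := g.exists_depth n
  obtain ⟨i, hi⟩ := List.mem_iff_getElem?.1 hk
  have := g.depth_le (hπ.append (π' := [i]) ⟨k, hi, rfl⟩)
  simp at this
  omega

theorem IsPath.snoc_inv {N : Type v} {suc : N → List N} {π : List ℕ} {i : ℕ} :
    ∀ {m n : N}, IsPath suc m (π ++ [i]) n → ∃ k, IsPath suc m π k ∧ (suc k)[i]? = some n := by
  induction π with
  | nil =>
    rintro m n ⟨k, hk, h⟩
    exact ⟨m, rfl, hk.trans (congrArg some h)⟩
  | cons j π ih =>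
    rintro m n ⟨a, ha, hp⟩
    obtain ⟨k, hk, hi⟩ := ih hp
    exact ⟨k, ⟨a, ha, hk⟩, hi⟩

open Classical in
/-- The simple truncation of a partial term graph at depth `d`. -/
noncomputable def TermGraph.trunc {Sg : Signature.{u}} {N : Type v} (g : TermGraph Sg.bot N)
    (d : ℕ) : TermGraph Sg.bot {n : N // g.depth n ≤ d} where
  lab := fun n => if g.depth n.1 < d then g.lab n.1 else Sg.botSym
  suc := fun n =>
    if h : g.depth n.1 < d then
      (g.suc n.1).attachWith (fun k => g.depth k ≤ d) (fun _ hk => g.depth_suc_le h hk)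
    else []
  suc_length := fun n => by
    by_cases h : g.depth n.1 < d
    · rw [dif_pos h, if_pos h, List.length_attachWith]; exact g.suc_length n.1
    · rw [dif_neg h, if_neg h]; rfl
  root := ⟨g.root, by rw [g.depth_root]; exact Nat.zero_le _⟩
  reachable := by
    suffices H : ∀ (k : ℕ) (n : {n : N // g.depth n ≤ d}), g.depth n.1 = k →
        Reach _ (⟨g.root, by rw [g.depth_root]; exact Nat.zero_le _⟩ :
          {n : N // g.depth n ≤ d}) n from fun n => H _ n rfl
    intro k
    induction k with
    | zero =>
      intro n hn
      obtain ⟨π, hπ, hl⟩ := g.exists_depth n.1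
      rw [hn, List.length_eq_zero_iff] at hl
      subst hl
      exact ⟨[], Subtype.ext hπ⟩
    | succ k ih =>
      intro n hn
      obtain ⟨π, hπ, hl⟩ := g.exists_depth n.1
      rcases List.eq_nil_or_concat π with rfl | ⟨π, i, rfl⟩
      · simp [hn] at hl
      rw [List.concat_eq_append] at hπ hl
      obtain ⟨m, hm, hi⟩ := hπ.snoc_inv
      have hlen : π.length = k := by
        simp at hl; omega
      have hmk : g.depth m ≤ k := hlen ▸ g.depth_le hm
      have hnm : g.depth n.1 ≤ g.depth m + 1 :=
        g.depth_suc_le (Nat.lt_succ_self _) (List.mem_of_getElem? hi)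
      have hnd := n.2
      have hmd : g.depth m < d := by omega
      refine Reach.step (ih ⟨m, hmd.le⟩ (by simp only; omega)) ?_
      rw [dif_pos hmd]
      rw [List.mem_attachWith]
      exact List.mem_of_getElem? hi

open Classical in
/-- The simple distance of canonical total term graphs. -/
noncomputable def sdist {Sg : Signature.{u}} (g h : CanTermGraph Sg) : ℝ :=
  if g = h then 0
  else (2 : ℝ)⁻¹ ^ sSup {e : ℕ | Iso (g.graph.toBot.trunc e) (h.graph.toBot.trunc e)}

/-! ### Limits and limits inferior of transfinite sequences -/

/-- The sequence `(g ι)_{ι < α}` converges to `a` w.r.t. the simple distance. -/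
def IsLim {Sg : Signature.{u}} (α : Ordinal.{y}) (g : Ordinal.{y} → CanTermGraph Sg)
    (a : CanTermGraph Sg) : Prop :=
  ∀ ε : ℝ, 0 < ε → ∃ β < α, ∀ ι, β ≤ ι → ι < α → sdist (g ι) a < ε

/-- The sequence `(g ι)_{ι < α}` has the limit inferior `⨆_{β < α} ⨅_{β ≤ ι < α} g ι`, and this
is `a`; the existence of the bounds is part of the assertion. -/
def IsLiminf {Sg : Signature.{u}} (α : Ordinal.{y}) (g : Ordinal.{y} → CanTermGraph Sg.bot)
    (a : CanTermGraph Sg.bot) : Prop :=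
  ∃ b : Ordinal.{y} → CanTermGraph Sg.bot,
    (∀ β < α, IsGLB (g '' Set.Ico β α) (b β)) ∧ IsLUB (b '' Set.Iio α) a

/-! ### Term graph rewriting systems -/

/-- A term graph rule over `Sg` with variables in `V`. -/
structure TermGraphRule (Sg : Signature.{u}) (V : Type w) where
  Node : Type v
  graph : Graph (Sg.withVars V) Node
  l : Node
  r : Node
  reachable : ∀ n, Reach graph.suc l n ∨ Reach graph.suc r n
  var_unique : ∀ (z : V) (m n : Node),
    graph.lab m = Sg.varSym V z → graph.lab n = Sg.varSym V z → m = n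
  var_ne : ∀ (z : V) (n : Node), graph.lab n = Sg.varSym V z → n ≠ l
  var_reach : ∀ (z : V) (n : Node), graph.lab n = Sg.varSym V z → Reach graph.suc l n

/-- The left-hand side of a rule. -/
def TermGraphRule.lhs {Sg : Signature.{u}} {V : Type w} (ρ : TermGraphRule.{u, v} Sg V) :
    TermGraph (Sg.withVars V) {m : ρ.Node // Reach ρ.graph.suc ρ.l m} :=
  ρ.graph.sub ρ.l

/-- The right-hand side of a rule. -/
def TermGraphRule.rhs {Sg : Signature.{u}} {V : Type w} (ρ : TermGraphRule.{u, v} Sg V) :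
    TermGraph (Sg.withVars V) {m : ρ.Node // Reach ρ.graph.suc ρ.r m} :=
  ρ.graph.sub ρ.r

/-- A rule over `Σ`, seen as a rule over `Σ_⊥`. -/
def TermGraphRule.toBot {Sg : Signature.{u}} {V : Type w} (ρ : TermGraphRule.{u, v} Sg V) :
    TermGraphRule.{u, v} Sg.bot V where
  Node := ρ.Node
  graph := ρ.graph.relabel
    (Sum.elim (fun s => Sg.bot.funSym V (Sg.toBotSym s)) (Sg.bot.varSym V))
    (by rintro (s | z) <;> rfl)
  l := ρ.l
  r := ρ.r
  reachable := ρ.reachable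
  var_unique := fun z m n hm hn => by
    have key : ∀ k, Sum.elim (fun s => Sg.bot.funSym V (Sg.toBotSym s)) (Sg.bot.varSym V)
        (ρ.graph.lab k) = Sg.bot.varSym V z → ρ.graph.lab k = Sg.varSym V z := by
      intro k hk
      rcases h : (ρ.graph.lab k : Sg.Sym ⊕ V) with s | z' <;> rw [h] at hk
      · cases hk
      · cases hk; rfl
    exact ρ.var_unique z m n (key m hm) (key n hn)
  var_ne := fun z n hn => by
    rcases h : (ρ.graph.lab n : Sg.Sym ⊕ V) with s | z'
    · simp only [Graph.relabel] at hn
      rw [h] at hn; cases hn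
    · exact ρ.var_ne z' n h
  var_reach := fun z n hn => by
    rcases h : (ρ.graph.lab n : Sg.Sym ⊕ V) with s | z'
    · simp only [Graph.relabel] at hn
      rw [h] at hn; cases hn
    · exact ρ.var_reach z' n h

/-- A term graph rewriting system over `Sg`: a set of rules. -/
abbrev GRS (Sg : Signature.{u}) (V : Type w) := Set (TermGraphRule.{u, v} Sg V)

/-- The system `R_⊥`: the same rules over the signature `Σ_⊥`. -/
def GRS.toBot {Sg : Signature.{u}} {V : Type w} (R : GRS.{u, v} Sg V) : GRS.{u, v} Sg.bot V :=
  TermGraphRule.toBot '' R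

/-! ### Pre-reduction steps -/

/-- The nodes of a rule that do not belong to its left-hand side. -/
abbrev TermGraphRule.New {Sg : Signature.{u}} {V : Type w} (ρ : TermGraphRule.{u, v} Sg V) :=
  {m : ρ.Node // ¬ Reach ρ.graph.suc ρ.l m}

/-- The (non-variable) label of a node outside the left-hand side. -/
def TermGraphRule.newLab {Sg : Signature.{u}} {V : Type w} (ρ : TermGraphRule.{u, v} Sg V)
    (m : ρ.New) : Sg.Sym :=
  match h : (ρ.graph.lab m.1 : Sg.Sym ⊕ V) with
  | Sum.inl s => s
  | Sum.inr z => (m.2 (ρ.var_reach z m.1 h)).elim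

theorem TermGraphRule.funSym_newLab {Sg : Signature.{u}} {V : Type w}
    (ρ : TermGraphRule.{u, v} Sg V) (m : ρ.New) :
    Sg.funSym V (ρ.newLab m) = ρ.graph.lab m.1 := by
  unfold TermGraphRule.newLab
  split
  next s h => exact h.symm
  next z h => exact (m.2 (ρ.var_reach z m.1 h)).elim

section Step

variable {Sg : Signature.{u}} {V : Type w} {N : Type x}

open Classical in
/-- Where a node of the rule ends up: nodes `m` of the left-hand side are replaced by `φ m`,
all others are copied. -/
noncomputable def TermGraphRule.place (ρ : TermGraphRule.{u, v} Sg V) (g : TermGraph Sg N)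
    (n : N) (φ : {m : ρ.Node // Reach ρ.graph.suc ρ.l m} → {k : N // Reach g.suc n k})
    (m : ρ.Node) : N ⊕ ρ.New :=
  if h : Reach ρ.graph.suc ρ.l m then Sum.inl (φ ⟨m, h⟩).1 else Sum.inr ⟨m, h⟩

/-- The graph `g` together with a copy of the nodes and edges of `ρ` that are not in the
left-hand side. -/
noncomputable def TermGraphRule.build (ρ : TermGraphRule.{u, v} Sg V) (g : TermGraph Sg N)
    (n : N) (φ : {m : ρ.Node // Reach ρ.graph.suc ρ.l m} → {k : N // Reach g.suc n k}) :
    Graph Sg (N ⊕ ρ.New) where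
  lab := Sum.elim g.lab ρ.newLab
  suc := Sum.elim (fun k => (g.suc k).map Sum.inl)
    (fun m => (ρ.graph.suc m.1).map (ρ.place g n φ))
  suc_length := by
    rintro (k | m)
    · simp only [Sum.elim_inl, List.length_map]; exact g.suc_length k
    · simp only [Sum.elim_inr, List.length_map]
      rw [ρ.graph.suc_length, ← ρ.funSym_newLab m]; rfl

open Classical in
/-- The function that replaces `a` by `b`. -/
noncomputable def redirect {A : Type y} (a b : A) (c : A) : A := if c = a then b else c

/-- Redirect all edges that point to `a` to `b`. -/
noncomputable def Graph.redirect {A : Type y} (g : Graph Sg A) (a b : A) : Graph Sg A where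
  lab := g.lab
  suc := fun k => (g.suc k).map (TermGraphRewriting.redirect a b)
  suc_length := fun k => by rw [List.length_map]; exact g.suc_length k

/-- The term graph that a pre-reduction step produces from `g`, the redex root `n` and the
matching `φ`: copy the right-hand side, redirect all edges (and the root pointer) from the root
of the redex to the root of the contractum, and remove the nodes that have become
unreachable. -/
noncomputable def TermGraphRule.contract (ρ : TermGraphRule.{u, v} Sg V) (g : TermGraph Sg N)
    (n : N) (φ : {m : ρ.Node // Reach ρ.graph.suc ρ.l m} → {k : N // Reach g.suc n k}) :=
  ((ρ.build g n φ).redirect (Sum.inl n) (ρ.place g n φ ρ.r)).sub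
    (redirect (Sum.inl n) (ρ.place g n φ ρ.r) (Sum.inl g.root))

/-- `φ` matches the left-hand side of `ρ` against the sub-term graph of `g` rooted in `n`. -/
def TermGraphRule.IsMatch (ρ : TermGraphRule.{u, v} Sg V) (g : TermGraph Sg N)
    (n : N) (φ : {m : ρ.Node // Reach ρ.graph.suc ρ.l m} → {k : N // Reach g.suc n k}) : Prop :=
  IsHom (Sg.vars V) ρ.lhs ((g.sub n).withVars V) φ

end Step

/-! ### Reduction steps and transfinite reductions -/

/-- The reduction steps of a rule: canonicalised pre-reduction steps. Term graphs are countable,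
so node types in `Type` are no restriction. -/
def TermGraphRule.Step {Sg : Signature.{u}} {V : Type w} (ρ : TermGraphRule.{u, v} Sg V)
    (g : CanTermGraph Sg) (n : g.nodes) (h : CanTermGraph Sg) : Prop :=
  ∃ (N : Type) (g' : TermGraph Sg N) (n' : N)
    (φ : {m : ρ.Node // Reach ρ.graph.suc ρ.l m} → {k : N // Reach g'.suc n' k}),
    ρ.IsMatch g' n' φ ∧ canon g' = g ∧ canon (ρ.contract g' n' φ) = h ∧
      (n : Set (List ℕ)) = g'.positions n'

/-- `g →_n h` in the system `R`. -/
def GRS.Step {Sg : Signature.{u}} {V : Type w} (R : GRS.{u, v} Sg V)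
    (g : CanTermGraph Sg) (n : g.nodes) (h : CanTermGraph Sg) : Prop :=
  ∃ ρ ∈ R, ρ.Step g n h

open Classical in
/-- The length of the underlying sequence of term graphs of a reduction of length `α`: this is
`α` if `α` is a limit ordinal, and `α + 1` otherwise. -/
noncomputable def seqLength (α : Ordinal.{y}) : Ordinal.{y} :=
  if Order.IsSuccLimit α then α else α + 1

/-- A transfinite sequence `(g_ι, n_ι, g_{ι+1})_{ι < len}` of potential reduction steps. Only the
values `graph ι` for `ι < seqLength len` and `node ι` for `ι < len` are meaningful; the others
are never used. -/
structure StepSeq (Sg : Signature.{u}) where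
  len : Ordinal.{y}
  graph : Ordinal.{y} → CanTermGraph Sg
  node : (ι : Ordinal.{y}) → (graph ι).nodes

/-- `S` is a reduction in `R`. -/
def IsReduction {Sg : Signature.{u}} {V : Type w} (R : GRS.{u, v} Sg V)
    (S : StepSeq.{u, y} Sg) : Prop :=
  ∀ ι < S.len, R.Step (S.graph ι) (S.node ι) (S.graph (ι + 1))

/-- A sequence of total term graphs, seen as a sequence of partial term graphs. -/
def StepSeq.toBot {Sg : Signature.{u}} (S : StepSeq.{u, y} Sg) : StepSeq.{u, y} Sg.bot where
  len := S.len
  graph := fun ι => (S.graph ι).toBot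
  node := S.node

/-! ### Weak convergence -/

/-- The reduction `S` is weakly m-continuous in `R`. -/
def WeaklyMContinuous {Sg : Signature.{u}} {V : Type w} (R : GRS.{u, v} Sg V)
    (S : StepSeq.{u, y} Sg) : Prop :=
  IsReduction R S ∧ ∀ o < S.len, Order.IsSuccLimit o → IsLim o S.graph (S.graph o)

/-- The reduction `S` weakly m-converges from `g` to `h` in `R`. -/
def WeaklyMConverges {Sg : Signature.{u}} {V : Type w} (R : GRS.{u, v} Sg V)
    (S : StepSeq.{u, y} Sg) (g h : CanTermGraph Sg) : Prop :=
  S.graph 0 = g ∧ WeaklyMContinuous R S ∧ IsLim (seqLength S.len) S.graph h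

/-- The reduction `S` in `R_⊥` is weakly p-continuous in `R`. -/
def WeaklyPContinuous {Sg : Signature.{u}} {V : Type w} (R : GRS.{u, v} Sg V)
    (S : StepSeq.{u, y} Sg.bot) : Prop :=
  IsReduction R.toBot S ∧ ∀ o < S.len, Order.IsSuccLimit o → IsLiminf o S.graph (S.graph o)

/-- The reduction `S` in `R_⊥` weakly p-converges from `g` to `h` in `R`. -/
def WeaklyPConverges {Sg : Signature.{u}} {V : Type w} (R : GRS.{u, v} Sg V)
    (S : StepSeq.{u, y} Sg.bot) (g h : CanTermGraph Sg.bot) : Prop :=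
  S.graph 0 = g ∧ WeaklyPContinuous R S ∧ IsLiminf (seqLength S.len) S.graph h

/-! ### The example -/

/-- A binary symbol `f` and a constant `c`. -/
inductive FCSym where
  | f
  | c

/-- The signature with a binary symbol `f` and a constant `c`. -/
def fcSig : Signature.{0} where
  Sym := FCSym
  arity := fun s => match s with
    | FCSym.f => 2
    | FCSym.c => 0

/-- The term tree `f(c, c)`, with two distinct nodes labelled `c`. -/
def fcTree : TermGraph fcSig (Fin 3) where
  lab := ![FCSym.f, FCSym.c, FCSym.c]
  suc := ![[1, 2], [], []]
  suc_length := fun n => by fin_cases n <;> rfl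
  root := 0
  reachable := fun n => by
    fin_cases n
    · exact ⟨[], rfl⟩
    · exact ⟨[0], 1, rfl, rfl⟩
    · exact ⟨[1], 2, rfl, rfl⟩

/-- The term graph `f(c, c)` in which the two arguments are the same node labelled `c`. -/
def fcShared : TermGraph fcSig (Fin 2) where
  lab := ![FCSym.f, FCSym.c]
  suc := ![[1, 1], []]
  suc_length := fun n => by fin_cases n <;> rfl
  root := 0
  reachable := fun n => by
    fin_cases n
    · exact ⟨[], rfl⟩
    · exact ⟨[0], 1, rfl, rfl⟩

/-- The variable-free rule whose graph is the disjoint union of `a` and `b`, with left-hand side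
`a` and right-hand side `b`. -/
def disjointRule {Sg : Signature.{u}} (V : Type w) {N M : Type v}
    (a : TermGraph Sg N) (b : TermGraph Sg M) : TermGraphRule.{u, v} Sg V where
  Node := N ⊕ M
  graph :=
    { lab := Sum.elim (fun n => Sg.funSym V (a.lab n)) (fun n => Sg.funSym V (b.lab n))
      suc := Sum.elim (fun n => (a.suc n).map Sum.inl) (fun n => (b.suc n).map Sum.inr)
      suc_length := by
        rintro (n | n)
        · simp only [Sum.elim_inl, List.length_map]; exact a.suc_length n
        · simp only [Sum.elim_inr, List.length_map]; exact b.suc_length n }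
  l := Sum.inl a.root
  r := Sum.inr b.root
  reachable := by
    rintro (n | n)
    · obtain ⟨π, hπ⟩ := a.reachable n
      exact Or.inl ⟨π, IsPath.map (φ := Sum.inl) (fun _ => rfl) hπ⟩
    · obtain ⟨π, hπ⟩ := b.reachable n
      exact Or.inr ⟨π, IsPath.map (φ := Sum.inr) (fun _ => rfl) hπ⟩
  var_unique := by rintro z (m | m) n h <;> cases h
  var_ne := by rintro z (m | m) h <;> cases h
  var_reach := by rintro z (m | m) h <;> cases h

/-- The system with the two rules `f(c, c) → f(c, c)` whose left-hand sides are the tree, and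
whose right-hand sides are the tree and the shared version, respectively. -/
def fcGRS (V : Type w) : GRS.{0, 0} fcSig V :=
  {disjointRule V fcTree fcTree, disjointRule V fcTree fcShared}

end TermGraphRewriting

open TermGraphRewriting

universe u v w y

/-!
Both halves rest on describing a `⊥`-homomorphism by positions: `g ≤ h` holds as soon as positions
that share a node in `g` share a node in `h` and every proper label of `g` occurs in `h` at the same
positions (`exists_isHom_of_positions`). Since each such requirement concerns finitely many
finite paths, it suffices that every truncation of `g` has a `⊥`-homomorphism to `h`
(`exists_isHom_of_trunc`).

*Limits are limits inferior* (`IsLim.isLiminf`). Every nonempty set of canonical partial term graphs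
has a greatest lower bound, namely the reachable part of the product of its members, where a tuple
of nodes keeps its label if all components agree on it and is labelled `⊥` otherwise
(`exists_isGLB`). If `sdist (g ι) a < 2⁻¹ ^ d`, then each of `g ι` and `a`, truncated at depth `d`,
maps to the other. So if `g` converges to `a`, a lower bound of a tail of `g` lies, up to
any depth, below some `g ι` close to `a` and hence below `a`; and each truncation of `a` lies below
a whole tail, hence below one of the greatest lower bounds and below every upper bound of these.
As steps in a system are also steps in its extension by `⊥` (`TermGraphRule.Step.toBot`), weak
m-convergence implies weak p-convergence.

*The converse fails.* The tree `f(c, c)` has a homomorphism to its shared version. So the left-hand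
sides match both, and the alternating reduction exists (`isReduction_fcSeq`). Moreover the tree is
the least element of every tail of it, hence the limit inferior (`isLiminf_fcSeq`). The
truncations of the two graphs at depth `1` already differ in the sharing of the positions `[0]` and
`[1]`, so that the reduction has no limit (`not_isLim_fcSeq`).
-/

namespace TermGraphRewriting

universe x

/-! ### Homomorphisms and paths -/

theorem IsHom.comp {Sg : Signature.{u}} {Δ : Set Sg.Sym} {N : Type v} {M : Type w} {K : Type x}
    {g : TermGraph Sg N} {h : TermGraph Sg M} {k : TermGraph Sg K} {φ : N → M} {ψ : M → K}
    (hψ : IsHom Δ h k ψ) (hφ : IsHom Δ g h φ) : IsHom Δ g k (ψ ∘ φ) where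
  map_root := by rw [Function.comp_apply, hφ.map_root, hψ.map_root]
  labelling := fun n hn => by
    have h1 := hφ.labelling n hn
    rw [h1] at hn ⊢
    exact hψ.labelling _ hn
  successor := fun n hn => by
    have h1 := hφ.labelling n hn
    rw [← List.map_map, hφ.successor n hn]
    exact hψ.successor _ (h1 ▸ hn)

theorem IsHom.of_empty {Sg : Signature.{u}} {N : Type v} {M : Type w} {g : TermGraph Sg N}
    {h : TermGraph Sg M} {φ : N → M} (hφ : IsHom ∅ g h φ) (Δ : Set Sg.Sym) : IsHom Δ g h φ :=
  ⟨hφ.map_root, fun n _ => hφ.labelling n id, fun n _ => hφ.successor n id⟩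

theorem IsHom.id {Sg : Signature.{u}} {N : Type v} (g : TermGraph Sg N) (Δ : Set Sg.Sym) :
    IsHom Δ g g _root_.id :=
  ⟨rfl, fun _ _ => rfl, fun _ _ => List.map_id _⟩

theorem IsHom.path {Sg : Signature.{u}} {N : Type v} {M : Type w} {g : TermGraph Sg N}
    {h : TermGraph Sg M} {φ : N → M} (hφ : IsHom ∅ g h φ) {π : List ℕ} {n : N}
    (hp : IsPath g.suc g.root π n) : IsPath h.suc h.root π (φ n) := by
  rw [← hφ.map_root]
  exact hp.map fun n => hφ.successor n _root_.id

theorem IsHom.exists_path {Sg : Signature.{u}} {N : Type v} {M : Type w} {g : TermGraph Sg N}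
    {h : TermGraph Sg M} {φ : N → M} (hφ : IsHom ∅ g h φ) {π : List ℕ} {m : M}
    (hp : IsPath h.suc h.root π m) : ∃ n, φ n = m ∧ IsPath g.suc g.root π n := by
  rw [← hφ.map_root] at hp
  exact hp.lift fun n => hφ.successor n _root_.id

theorem IsHom.surjective {Sg : Signature.{u}} {N : Type v} {M : Type w} {g : TermGraph Sg N}
    {h : TermGraph Sg M} {φ : N → M} (hφ : IsHom ∅ g h φ) : Function.Surjective φ := by
  intro m
  obtain ⟨π, hπ⟩ := h.reachable m
  obtain ⟨n, hn, -⟩ := hφ.exists_path hπ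
  exact ⟨n, hn⟩

theorem IsHom.symm {Sg : Signature.{u}} {N : Type v} {M : Type w} {g : TermGraph Sg N}
    {h : TermGraph Sg M} {e : N ≃ M} (he : IsHom ∅ g h e) : IsHom ∅ h g e.symm where
  map_root := by rw [← he.map_root, e.symm_apply_apply]
  labelling := fun m _ => by
    rw [he.labelling (e.symm m) _root_.id, e.apply_symm_apply]
  successor := fun m _ => by
    have := he.successor (e.symm m) _root_.id
    rw [e.apply_symm_apply] at this
    rw [← this, List.map_map]
    simp

theorem Iso.symm {Sg : Signature.{u}} {N : Type v} {M : Type w} {g : TermGraph Sg N}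
    {h : TermGraph Sg M} (H : Iso g h) : Iso h g := by
  obtain ⟨φ, hb, hφ⟩ := H
  exact ⟨(Equiv.ofBijective φ hb).symm, Equiv.bijective _,
    IsHom.symm (e := Equiv.ofBijective φ hb) hφ⟩

/-- Only nodes with successors need to have their edges preserved: every step of a path leaves
such a node. -/
theorem IsPath.map_of_ne_nil {N : Type v} {M : Type w} {suc : N → List N} {suc' : M → List M}
    {φ : N → M} (hφ : ∀ n, suc n ≠ [] → (suc n).map φ = suc' (φ n)) {π : List ℕ} :
    ∀ {m n : N}, IsPath suc m π n → IsPath suc' (φ m) π (φ n) := by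
  induction π with
  | nil => intro m n h; exact congrArg φ h
  | cons i π ih =>
    rintro m n ⟨k, hk, hp⟩
    refine ⟨φ k, ?_, ih hp⟩
    rw [← hφ m (by rintro h; rw [h] at hk; cases hk), List.getElem?_map, hk]; rfl

theorem Graph.lab_ne_botSym {Sg : Signature.{u}} {N : Type v} (g : Graph Sg.bot N) {n : N}
    (hn : g.suc n ≠ []) : g.lab n ≠ Sg.botSym := by
  intro h
  have h0 := g.suc_length n
  rw [h] at h0
  exact hn (List.length_eq_zero_iff.1 h0)

theorem IsHom.path_of_bot {Sg : Signature.{u}} {N : Type v} {M : Type w}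
    {g : TermGraph Sg.bot N} {h : TermGraph Sg.bot M} {φ : N → M}
    (hφ : IsHom {Sg.botSym} g h φ) {π : List ℕ} {n : N}
    (hp : IsPath g.suc g.root π n) : IsPath h.suc h.root π (φ n) := by
  rw [← hφ.map_root]
  exact hp.map_of_ne_nil fun m hm => hφ.successor m (g.lab_ne_botSym hm)

/-- A `⊥`-homomorphism exists as soon as shared positions remain shared and proper labels remain
in place: a node is sent to the node at the same positions. -/
theorem exists_isHom_of_positions {Sg : Signature.{u}} {N : Type v} {M : Type w}
    {g : TermGraph Sg.bot N} {h : TermGraph Sg.bot M}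
    (h1 : ∀ π π' n, IsPath g.suc g.root π n → IsPath g.suc g.root π' n →
      ∃ m, IsPath h.suc h.root π m ∧ IsPath h.suc h.root π' m)
    (h2 : ∀ π n, IsPath g.suc g.root π n → g.lab n ≠ Sg.botSym →
      ∃ m, IsPath h.suc h.root π m ∧ g.lab n = h.lab m) :
    ∃ φ, IsHom {Sg.botSym} g h φ := by
  choose p hp using g.reachable
  choose φ hφ _ using fun n => h1 _ _ n (hp n) (hp n)
  have key : ∀ π n, IsPath g.suc g.root π n → IsPath h.suc h.root π (φ n) := by
    intro π n hn
    obtain ⟨m, hm, hm'⟩ := h1 _ _ n hn (hp n)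
    rwa [(hφ n).unique hm']
  have hlab : ∀ n, g.lab n ∉ ({Sg.botSym} : Set _) → g.lab n = h.lab (φ n) := by
    intro n hn
    obtain ⟨m, hm, hl⟩ := h2 _ n (hp n) hn
    rw [hl, hm.unique (hφ n)]
  refine ⟨φ, (key [] g.root rfl).symm, hlab, fun n hn => ?_⟩
  refine List.ext_getElem ?_ fun i hi hi' => ?_
  · rw [List.length_map, g.suc_length, h.suc_length, hlab n hn]
  · rw [List.length_map] at hi
    have hk : (g.suc n)[i]? = some (g.suc n)[i] := List.getElem?_eq_getElem hi
    obtain ⟨m, hm, hmi⟩ := (key _ _ ((hp n).append (π' := [i]) ⟨_, hk, rfl⟩)).snoc_inv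
    rw [hm.unique (hφ n), List.getElem?_eq_getElem hi'] at hmi
    rw [List.getElem_map]
    exact (Option.some.inj hmi).symm

/-! ### Canonical representatives -/

theorem isHom_canon {Sg : Signature.{u}} {N : Type v} (g : TermGraph Sg N) :
    IsHom ∅ g (canon g).graph g.posEquiv where
  map_root := rfl
  labelling := fun n _ => (congrArg g.lab (g.posEquiv.symm_apply_apply n)).symm
  successor := fun n _ => g.posEquiv_suc n

theorem isHom_canon_symm {Sg : Signature.{u}} {N : Type v} (g : TermGraph Sg N) :
    IsHom ∅ (canon g).graph g g.posEquiv.symm :=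
  (isHom_canon g).symm

/-- An isomorphism preserves positions, hence is the identity on the nodes of canonical term
graphs. -/
theorem CanTermGraph.eq_of_iso {Sg : Signature.{u}} {g h : CanTermGraph Sg}
    (H : Iso g.graph h.graph) : g = h := by
  obtain ⟨φ, hb, hφ⟩ := H
  have hval : ∀ n, (φ n : Set (List ℕ)) = n := by
    intro n
    rw [h.canonical, g.canonical]
    ext π
    refine ⟨fun hp => ?_, fun hp => hφ.path hp⟩
    obtain ⟨m, hm, hp⟩ := hφ.exists_path hp
    rwa [hb.1 hm] at hp
  obtain ⟨A, g, hg⟩ := g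
  obtain ⟨B, h, hh⟩ := h
  obtain rfl : A = B := by
    ext n
    refine ⟨fun hn => ?_, fun hn => ?_⟩
    · have := (φ ⟨n, hn⟩).2
      rwa [hval] at this
    · obtain ⟨m, hm⟩ := hb.2 ⟨n, hn⟩
      have h1 := hval m
      rw [hm] at h1
      rw [show n = m.1 from h1]
      exact m.2
  obtain rfl : φ = _root_.id := funext fun n => Subtype.ext (hval n)
  congr 1
  obtain ⟨⟨l1, s1, a1⟩, r1, b1⟩ := g
  obtain ⟨⟨l2, s2, a2⟩, r2, b2⟩ := h
  obtain rfl : l1 = l2 := funext fun n => hφ.labelling n _root_.id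
  obtain rfl : s1 = s2 := funext fun n => by
    rw [← List.map_id (s1 n)]; exact hφ.successor n _root_.id
  obtain rfl : r1 = r2 := hφ.map_root
  rfl

theorem canon_eq_of_isHom_injective {Sg : Signature.{u}} {N : Type v} {M : Type w}
    {g : TermGraph Sg N} {h : TermGraph Sg M} {φ : N → M} (hφ : IsHom ∅ g h φ)
    (hi : Function.Injective φ) : canon g = canon h := by
  refine CanTermGraph.eq_of_iso ⟨h.posEquiv ∘ φ ∘ g.posEquiv.symm, ?_,
    (isHom_canon h).comp (hφ.comp (isHom_canon_symm g))⟩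
  exact h.posEquiv.bijective.comp (Function.Bijective.comp ⟨hi, hφ.surjective⟩
    g.posEquiv.symm.bijective)

theorem canon_toBot {Sg : Signature.{u}} {N : Type v} (g : TermGraph Sg N) :
    canon g.toBot = (canon g).toBot := rfl

/-! ### Greatest lower bounds of partial term graphs -/

theorem CanTermGraph.le_trans {Sg : Signature.{u}} {g h k : CanTermGraph Sg.bot}
    (h1 : g ≤ h) (h2 : h ≤ k) : g ≤ k := by
  obtain ⟨φ, hφ⟩ := h1
  obtain ⟨ψ, hψ⟩ := h2
  exact ⟨ψ ∘ φ, hψ.comp hφ⟩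

theorem CanTermGraph.le_refl {Sg : Signature.{u}} (g : CanTermGraph Sg.bot) : g ≤ g :=
  ⟨_root_.id, IsHom.id _ _⟩

theorem canon_le_iff {Sg : Signature.{u}} {N : Type v} {g : TermGraph Sg.bot N}
    {h : CanTermGraph Sg.bot} :
    canon g ≤ h ↔ ∃ φ, IsHom {Sg.botSym} g h.graph φ := by
  constructor
  · rintro ⟨φ, hφ⟩
    exact ⟨_, hφ.comp ((isHom_canon g).of_empty _)⟩
  · rintro ⟨φ, hφ⟩
    exact ⟨_, hφ.comp ((isHom_canon_symm g).of_empty _)⟩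

open Classical in
/-- The product of the graphs `t i`: a tuple of nodes carries the label common to all its
components and has tuples of successors as successors; a tuple without common label is labelled
`⊥`. The common label is read off at the index `i₀`. -/
noncomputable def prodGraph {Sg : Signature.{u}} {I : Type v} {N : I → Type w}
    (t : ∀ i, Graph Sg.bot (N i)) (i₀ : I) : Graph Sg.bot (∀ i, N i) where
  lab := fun n => if ∀ i, (t i).lab (n i) = (t i₀).lab (n i₀) then (t i₀).lab (n i₀)
    else Sg.botSym
  suc := fun n =>
    if h : ∀ i, (t i).lab (n i) = (t i₀).lab (n i₀) then
      List.ofFn fun (j : Fin (Sg.bot.arity ((t i₀).lab (n i₀)))) i =>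
        ((t i).suc (n i))[j.1]'(by rw [(t i).suc_length, h i]; exact j.2)
    else []
  suc_length := fun n => by
    split_ifs with h
    · rw [List.length_ofFn]
    · rfl

theorem prodGraph_lab {Sg : Signature.{u}} {I : Type v} {N : I → Type w}
    (t : ∀ i, Graph Sg.bot (N i)) (i₀ : I) {n : ∀ i, N i} {s : Sg.bot.Sym}
    (h : ∀ i, (t i).lab (n i) = s) : (prodGraph t i₀).lab n = s := by
  simp [prodGraph, h]

theorem prodGraph_lab_of_ne {Sg : Signature.{u}} {I : Type v} {N : I → Type w}
    (t : ∀ i, Graph Sg.bot (N i)) (i₀ : I) {n : ∀ i, N i}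
    (hn : (prodGraph t i₀).lab n ≠ Sg.botSym) (i : I) :
    (prodGraph t i₀).lab n = (t i).lab (n i) := by
  simp only [prodGraph] at hn ⊢
  split_ifs at hn ⊢ with h
  · exact (h i).symm
  · exact absurd rfl hn

theorem prodGraph_suc_map {Sg : Signature.{u}} {I : Type v} {N : I → Type w}
    (t : ∀ i, Graph Sg.bot (N i)) (i₀ : I) {n : ∀ i, N i}
    (hn : (prodGraph t i₀).lab n ≠ Sg.botSym) (i : I) :
    ((prodGraph t i₀).suc n).map (fun m => m i) = (t i).suc (n i) := by
  refine List.ext_getElem ?_ fun j hj hj' => ?_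
  · rw [List.length_map, (prodGraph t i₀).suc_length, prodGraph_lab_of_ne t i₀ hn i,
      (t i).suc_length]
  · simp only [prodGraph] at hn
    split_ifs at hn with h
    · simp [prodGraph, h]
    · exact absurd rfl hn

/-- The part of the product that is reachable from the tuple of roots is a greatest lower
bound: the projections are `⊥`-homomorphisms, and a family of `⊥`-homomorphisms combines into one
to the product. -/
theorem exists_isGLB {Sg : Signature.{u}} {G : Set (CanTermGraph Sg.bot)} (hG : G.Nonempty) :
    ∃ b, IsGLB G b := by
  obtain ⟨g₀, hg₀⟩ := hG
  let i₀ : G := ⟨g₀, hg₀⟩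
  let t := fun g : G => g.1.graph.toGraph
  let p := (prodGraph t i₀).sub fun g => g.1.graph.root
  refine ⟨canon p, fun g hg => canon_le_iff.2 ⟨fun n => n.1 ⟨g, hg⟩, rfl,
    fun n hn => prodGraph_lab_of_ne t i₀ hn ⟨g, hg⟩, fun n hn => ?_⟩, fun k hk => ?_⟩
  · have h1 : (p.suc n).map Subtype.val = (prodGraph t i₀).suc n.1 :=
      List.attachWith_map_subtype_val _
    refine Eq.trans ?_ (prodGraph_suc_map t i₀ hn ⟨g, hg⟩)
    rw [← h1, List.map_map]; rfl
  · choose φ hφ using fun g : G => hk g.2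
    have hl : ∀ n, k.graph.lab n ≠ Sg.botSym →
        (prodGraph t i₀).lab (fun g => φ g n) = k.graph.lab n := fun n hn =>
      prodGraph_lab t i₀ fun g => ((hφ g).labelling n hn).symm
    have hs : ∀ n, k.graph.lab n ≠ Sg.botSym →
        (k.graph.suc n).map (fun m g => φ g m) = (prodGraph t i₀).suc fun g => φ g n := by
      intro n hn
      have hn' : (prodGraph t i₀).lab (fun g => φ g n) ≠ Sg.botSym := by rwa [hl n hn]
      refine List.ext_getElem ?_ fun j hj hj' => funext fun g => ?_
      · rw [List.length_map, k.graph.suc_length, (prodGraph t i₀).suc_length, hl n hn]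
      · have h1 := ((hφ g).successor n hn).trans (prodGraph_suc_map t i₀ hn' g).symm
        have h2 := congrArg (fun l => l[j]?) h1
        rw [List.length_map] at hj
        simpa [hj, hj'] using h2
    have hr : ∀ n, Reach (prodGraph t i₀).suc (fun g => g.1.graph.root) fun g => φ g n := by
      intro n
      obtain ⟨π, hπ⟩ := k.graph.reachable n
      have h := hπ.map_of_ne_nil fun m hm => hs m (k.graph.lab_ne_botSym hm)
      rw [show (fun g => φ g k.graph.root) = fun g : G => g.1.graph.root from
        funext fun g => (hφ g).map_root] at h
      exact ⟨π, h⟩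
    have hψ : IsHom {Sg.botSym} k.graph p fun n => ⟨fun g => φ g n, hr n⟩ := by
      refine ⟨Subtype.ext (funext fun g => (hφ g).map_root), fun n hn => (hl n hn).symm,
        fun n hn => ?_⟩
      refine List.map_injective_iff.2 Subtype.val_injective ?_
      rw [List.map_map]
      exact (hs n hn).trans (List.attachWith_map_subtype_val _).symm
    exact ⟨_, ((isHom_canon p).of_empty _).comp hψ⟩

/-! ### Truncation -/

theorem TermGraph.trunc_lab {Sg : Signature.{u}} {N : Type v} (g : TermGraph Sg.bot N) {d : ℕ}
    {n : {n : N // g.depth n ≤ d}} (hn : g.depth n.1 < d) : (g.trunc d).lab n = g.lab n.1 :=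
  if_pos hn

theorem TermGraph.trunc_suc {Sg : Signature.{u}} {N : Type v} (g : TermGraph Sg.bot N) {d : ℕ}
    {n : {n : N // g.depth n ≤ d}} (hn : g.depth n.1 < d) :
    ((g.trunc d).suc n).map Subtype.val = g.suc n.1 := by
  rw [show (g.trunc d).suc n = _ from dif_pos hn]
  exact List.attachWith_map_subtype_val _

theorem TermGraph.depth_lt_of_trunc_lab {Sg : Signature.{u}} {N : Type v}
    (g : TermGraph Sg.bot N) {d : ℕ} {n : {n : N // g.depth n ≤ d}}
    (hn : (g.trunc d).lab n ≠ Sg.botSym) : g.depth n.1 < d := by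
  by_contra h
  exact hn (if_neg h)

theorem TermGraph.isHom_trunc_val {Sg : Signature.{u}} {N : Type v} (g : TermGraph Sg.bot N)
    (d : ℕ) : IsHom {Sg.botSym} (g.trunc d) g Subtype.val where
  map_root := rfl
  labelling := fun _ hn => g.trunc_lab (g.depth_lt_of_trunc_lab hn)
  successor := fun _ hn => g.trunc_suc (g.depth_lt_of_trunc_lab hn)

theorem TermGraph.isHom_trunc_trunc {Sg : Signature.{u}} {N : Type v} (g : TermGraph Sg.bot N)
    {d e : ℕ} (hde : d ≤ e) :
    IsHom {Sg.botSym} (g.trunc d) (g.trunc e) fun n => ⟨n.1, n.2.trans hde⟩ where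
  map_root := rfl
  labelling := fun n hn => by
    have h := g.depth_lt_of_trunc_lab hn
    exact (g.trunc_lab h).trans (g.trunc_lab (n := ⟨n.1, n.2.trans hde⟩) (h.trans_le hde)).symm
  successor := fun n hn => by
    have h := g.depth_lt_of_trunc_lab hn
    refine List.map_injective_iff.2 Subtype.val_injective ?_
    rw [List.map_map]
    exact (g.trunc_suc h).trans (g.trunc_suc (n := ⟨n.1, n.2.trans hde⟩)
      (h.trans_le hde)).symm

theorem IsHom.trunc {Sg : Signature.{u}} {N : Type v} {M : Type w} {g : TermGraph Sg.bot N}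
    {h : TermGraph Sg.bot M} {φ : N → M} (hφ : IsHom {Sg.botSym} g h φ) (d : ℕ) :
    ∃ ψ, IsHom {Sg.botSym} (g.trunc d) (h.trunc d) ψ := by
  have hd : ∀ n, h.depth (φ n) ≤ g.depth n := fun n => by
    obtain ⟨π, hπ, hl⟩ := g.exists_depth n
    exact hl ▸ h.depth_le (hφ.path_of_bot hπ)
  refine ⟨fun n => ⟨φ n.1, (hd n.1).trans n.2⟩, Subtype.ext hφ.map_root, fun n hn => ?_,
    fun n hn => ?_⟩ <;> have hlt := g.depth_lt_of_trunc_lab hn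
  · rw [g.trunc_lab hlt] at hn ⊢
    exact (hφ.labelling n.1 hn).trans
      (h.trunc_lab (n := ⟨φ n.1, (hd n.1).trans n.2⟩) ((hd n.1).trans_lt hlt)).symm
  · rw [g.trunc_lab hlt] at hn
    refine List.map_injective_iff.2 Subtype.val_injective ?_
    refine Eq.trans ?_ (h.trunc_suc (n := ⟨φ n.1, (hd n.1).trans n.2⟩)
      ((hd n.1).trans_lt hlt)).symm
    rw [← hφ.successor n.1 hn, ← g.trunc_suc hlt, List.map_map, List.map_map]
    rfl

/-- A path of length at most `d` survives in the truncation at depth `d`, because all nodes that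
it leaves have depth less than `d`. -/
theorem TermGraph.trunc_path {Sg : Signature.{u}} {N : Type v} (g : TermGraph Sg.bot N) {d : ℕ}
    {π : List ℕ} {n : N} (hp : IsPath g.suc g.root π n) (hd : π.length ≤ d) :
    IsPath (g.trunc d).suc (g.trunc d).root π ⟨n, (g.depth_le hp).trans hd⟩ := by
  induction π using List.reverseRecOn generalizing n with
  | nil => exact Subtype.ext hp
  | append_singleton π i ih =>
    obtain ⟨k, hk, hi⟩ := hp.snoc_inv
    rw [List.length_append, List.length_singleton] at hd
    refine (ih hk (by omega)).append ⟨⟨n, _⟩, ?_, rfl⟩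
    have hkd : g.depth k < d := (g.depth_le hk).trans_lt (by omega)
    refine Option.map_injective Subtype.val_injective ?_
    rw [← List.getElem?_map, g.trunc_suc hkd, hi]
    rfl

theorem IsHom.exists_path_of_trunc {Sg : Signature.{u}} {N : Type v} {M : Type w}
    {g : TermGraph Sg.bot N} {h : TermGraph Sg.bot M} {d : ℕ} {ψ : {n : N // g.depth n ≤ d} → M}
    (hψ : IsHom {Sg.botSym} (g.trunc d) h ψ) {π π' : List ℕ} {n : N}
    (hp : IsPath g.suc g.root π n) (hp' : IsPath g.suc g.root π' n) (hd : π.length ≤ d)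
    (hd' : π'.length ≤ d) :
    ∃ m, IsPath h.suc h.root π m ∧ IsPath h.suc h.root π' m :=
  ⟨_, hψ.path_of_bot (g.trunc_path hp hd), hψ.path_of_bot (g.trunc_path hp' hd')⟩

theorem IsHom.exists_lab_of_trunc {Sg : Signature.{u}} {N : Type v} {M : Type w}
    {g : TermGraph Sg.bot N} {h : TermGraph Sg.bot M} {d : ℕ} {ψ : {n : N // g.depth n ≤ d} → M}
    (hψ : IsHom {Sg.botSym} (g.trunc d) h ψ) {π : List ℕ} {n : N}
    (hp : IsPath g.suc g.root π n) (hd : π.length < d) (hn : g.lab n ≠ Sg.botSym) :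
    ∃ m, IsPath h.suc h.root π m ∧ g.lab n = h.lab m := by
  refine ⟨_, hψ.path_of_bot (g.trunc_path hp hd.le), ?_⟩
  have hl := g.trunc_lab (n := ⟨n, (g.depth_le hp).trans hd.le⟩) ((g.depth_le hp).trans_lt hd)
  rw [← hψ.labelling _ (by rw [hl]; exact hn), hl]

theorem Iso.exists_isHom_trunc {Sg : Signature.{u}} {N : Type v} {M : Type w}
    {g : TermGraph Sg.bot N} {h : TermGraph Sg.bot M} {d e : ℕ} (hde : d ≤ e)
    (H : Iso (g.trunc e) (h.trunc e)) : ∃ ψ, IsHom {Sg.botSym} (g.trunc d) h ψ := by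
  obtain ⟨φ, -, hφ⟩ := H
  exact ⟨_, (h.isHom_trunc_val e).comp ((hφ.of_empty _).comp (g.isHom_trunc_trunc hde))⟩

/-! ### The simple distance -/

theorem exists_iso_trunc_of_sdist_lt {Sg : Signature.{u}} {g h : CanTermGraph Sg} {d : ℕ}
    (H : sdist g h < (2 : ℝ)⁻¹ ^ d) :
    ∃ e, d ≤ e ∧ Iso (g.graph.toBot.trunc e) (h.graph.toBot.trunc e) := by
  by_cases hgh : g = h
  · subst hgh
    exact ⟨d, le_rfl, _root_.id, Function.bijective_id, IsHom.id _ _⟩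
  · rw [sdist, if_neg hgh] at H
    have hd := (pow_lt_pow_iff_right_of_lt_one₀ (by norm_num) (by norm_num)).1 H
    -- The supremum is positive, so it is attained: an empty or unbounded set has supremum `0`.
    refine ⟨_, hd.le, Nat.sSup_mem (s := {e : ℕ |
      Iso (g.graph.toBot.trunc e) (h.graph.toBot.trunc e)}) ?_ ?_⟩
    · by_contra h0
      rw [Set.not_nonempty_iff_eq_empty.1 h0] at hd
      simp at hd
    · by_contra h0
      rw [Nat.sSup_of_not_bddAbove h0] at hd
      exact Nat.not_lt_zero _ hd

theorem exists_isHom_trunc_of_sdist_lt {Sg : Signature.{u}} {g h : CanTermGraph Sg} {d : ℕ}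
    (H : sdist g h < (2 : ℝ)⁻¹ ^ d) :
    (∃ ψ, IsHom {Sg.botSym} (g.graph.toBot.trunc d) h.toBot.graph ψ) ∧
      ∃ ψ, IsHom {Sg.botSym} (h.graph.toBot.trunc d) g.toBot.graph ψ := by
  obtain ⟨e, hde, he⟩ := exists_iso_trunc_of_sdist_lt H
  exact ⟨he.exists_isHom_trunc hde, he.symm.exists_isHom_trunc hde⟩

/-! ### Limits are limits inferior -/

/-- A `⊥`-homomorphism from `g` to `h` can be checked on finitely much information at a time. -/
theorem exists_isHom_of_trunc {Sg : Signature.{u}} {N : Type v} {M : Type w}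
    {g : TermGraph Sg.bot N} {h : TermGraph Sg.bot M}
    (H : ∀ d, ∃ ψ, IsHom {Sg.botSym} (g.trunc d) h ψ) : ∃ φ, IsHom {Sg.botSym} g h φ := by
  refine exists_isHom_of_positions (fun π π' n hp hp' => ?_) fun π n hp hn => ?_
  · obtain ⟨ψ, hψ⟩ := H (max π.length π'.length)
    exact hψ.exists_path_of_trunc hp hp' (le_max_left _ _) (le_max_right _ _)
  · obtain ⟨ψ, hψ⟩ := H (π.length + 1)
    exact hψ.exists_lab_of_trunc hp (Nat.lt_succ_self _) hn

/-- A limit is a limit inferior. By convergence, each `⨅_{β ≤ ι < α} g ι` lies below the limit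
up to every depth; conversely, each truncation of the limit lies below almost all `g ι`, hence
below one of the greatest lower bounds. -/
theorem IsLim.isLiminf {Sg : Signature.{u}} {α : Ordinal.{y}}
    {g : Ordinal.{y} → CanTermGraph Sg} {a : CanTermGraph Sg} (H : IsLim α g a) :
    IsLiminf α (fun ι => (g ι).toBot) a.toBot := by
  have hb : ∀ β, ∃ b, β < α → IsGLB ((fun ι => (g ι).toBot) '' Set.Ico β α) b := by
    intro β
    by_cases hβ : β < α
    · obtain ⟨b, hb⟩ := exists_isGLB (G := (fun ι => (g ι).toBot) '' Set.Ico β α)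
        ⟨_, β, ⟨le_rfl, hβ⟩, rfl⟩
      exact ⟨b, fun _ => hb⟩
    · exact ⟨a.toBot, fun h => absurd h hβ⟩
  choose b hb using hb
  have hlim : ∀ d : ℕ, ∃ β < α, ∀ ι, β ≤ ι → ι < α → sdist (g ι) a < (2 : ℝ)⁻¹ ^ d :=
    fun d => H _ (by positivity)
  refine ⟨b, hb, ?_, fun c hc => ?_⟩
  · rintro _ ⟨β, hβ, rfl⟩
    refine exists_isHom_of_trunc fun d => ?_
    obtain ⟨γ, hγ, hι⟩ := hlim d
    obtain ⟨⟨ψ, hψ⟩, -⟩ := exists_isHom_trunc_of_sdist_lt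
      (hι (max β γ) (le_max_right _ _) (max_lt hβ hγ))
    obtain ⟨φ, hφ⟩ := (hb β hβ).1 ⟨max β γ, ⟨le_max_left _ _, max_lt hβ hγ⟩, rfl⟩
    obtain ⟨χ, hχ⟩ := hφ.trunc d
    exact ⟨_, hψ.comp hχ⟩
  · refine exists_isHom_of_trunc fun d => ?_
    obtain ⟨γ, hγ, hι⟩ := hlim d
    have hle : canon (a.graph.toBot.trunc d) ≤ b γ := by
      refine (hb γ hγ).2 ?_
      rintro _ ⟨ι, hι', rfl⟩
      exact canon_le_iff.2 (exists_isHom_trunc_of_sdist_lt (hι ι hι'.1 hι'.2)).2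
    exact canon_le_iff.1 (CanTermGraph.le_trans hle (hc ⟨γ, hγ, rfl⟩))

/-! ### Reductions of total term graphs as reductions of partial term graphs -/

theorem TermGraphRule.toBot_newLab {Sg : Signature.{u}} {V : Type w}
    (ρ : TermGraphRule.{u, v} Sg V) (m : ρ.New) :
    ρ.toBot.newLab m = Sg.toBotSym (ρ.newLab m) := by
  have h1 := ρ.toBot.funSym_newLab m
  have h2 := ρ.funSym_newLab m
  have h3 : ρ.toBot.graph.lab m.1 = Sg.bot.funSym V (Sg.toBotSym (ρ.newLab m)) := by
    change Sum.elim _ _ (ρ.graph.lab m.1) = _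
    rw [← h2]; rfl
  exact Sum.inl_injective (h1.trans h3)

theorem TermGraphRule.canon_toBot_contract {Sg : Signature.{u}} {V : Type w} {N : Type x}
    (ρ : TermGraphRule.{u, v} Sg V) (g : TermGraph Sg N) (n : N)
    (φ : {m : ρ.Node // Reach ρ.graph.suc ρ.l m} → {k : N // Reach g.suc n k}) :
    canon (ρ.toBot.contract g.toBot n φ) = (canon (ρ.contract g n φ)).toBot := by
  refine canon_eq_of_isHom_injective (h := (ρ.contract g n φ).toBot) (φ := fun m => m)
    ⟨rfl, ?_, fun m _ => List.map_id _⟩ fun _ _ h => h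
  rintro ⟨k | m, hm⟩ -
  · rfl
  · exact ρ.toBot_newLab m

theorem TermGraphRule.Step.toBot {Sg : Signature.{u}} {V : Type w} {ρ : TermGraphRule.{u, v} Sg V}
    {g h : CanTermGraph Sg} {n : g.nodes} (H : ρ.Step g n h) : ρ.toBot.Step g.toBot n h.toBot := by
  obtain ⟨N, g', n', φ, hφ, rfl, rfl, hn⟩ := H
  have hv : ∀ m, ρ.toBot.lhs.lab m ∉ Sg.bot.vars V → ρ.lhs.lab m ∉ Sg.vars V := by
    rintro m hm ⟨z, hz⟩
    refine hm ⟨z, ?_⟩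
    change _ = Sum.elim _ _ (ρ.lhs.lab m)
    rw [← hz]; rfl
  refine ⟨N, g'.toBot, n', φ, ⟨hφ.map_root, fun m hm => ?_, fun m hm => ?_⟩, rfl,
    ρ.canon_toBot_contract g' n' φ, hn⟩
  · change Sum.elim _ _ (ρ.lhs.lab m) = _
    rw [hφ.labelling m (hv m hm)]; rfl
  · exact hφ.successor m (hv m hm)

theorem IsReduction.toBot {Sg : Signature.{u}} {V : Type w} {R : GRS.{u, v} Sg V}
    {S : StepSeq.{u, y} Sg} (H : IsReduction R S) : IsReduction R.toBot S.toBot := by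
  intro ι hι
  obtain ⟨ρ, hρ, h⟩ := H ι hι
  exact ⟨ρ.toBot, ⟨ρ, hρ, rfl⟩, h.toBot⟩

theorem WeaklyMConverges.toBot {Sg : Signature.{u}} {V : Type w} {R : GRS.{u, v} Sg V}
    {S : StepSeq.{u, y} Sg} {g h : CanTermGraph Sg} (H : WeaklyMConverges R S g h) :
    WeaklyPConverges R S.toBot g.toBot h.toBot := by
  obtain ⟨h0, ⟨hR, hc⟩, hl⟩ := H
  exact ⟨congrArg CanTermGraph.toBot h0,
    ⟨hR.toBot, fun o ho ho' => (hc o ho ho').isLiminf⟩, hl.isLiminf⟩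

/-! ### Steps of variable-free rules with disjoint sides -/

theorem not_reach_disjointRule_inr {Sg : Signature.{u}} (V : Type w) {N M : Type v}
    (a : TermGraph Sg N) (b : TermGraph Sg M) (m : M) :
    ¬ Reach (disjointRule V a b).graph.suc (disjointRule V a b).l (Sum.inr m) := by
  rintro ⟨π, hπ⟩
  obtain ⟨k, hk, -⟩ := IsPath.lift (suc := a.suc) (φ := Sum.inl) (fun _ => rfl) hπ
  cases hk

/-- The copy of the right-hand side is disjoint from `g` and the root pointer is redirected to it,
so that removing the unreachable nodes leaves precisely this copy. -/
theorem canon_contract_disjointRule {Sg : Signature.{u}} (V : Type w) {N M : Type v} {K : Type x}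
    (a : TermGraph Sg N) (b : TermGraph Sg M) (g : TermGraph Sg K)
    (φ : {m // Reach (disjointRule V a b).graph.suc (disjointRule V a b).l m} →
      {k // Reach g.suc g.root k}) :
    canon ((disjointRule V a b).contract g g.root φ) = canon b := by
  let ρ := disjointRule V a b
  have hnew := not_reach_disjointRule_inr V a b
  let c : M → K ⊕ ρ.New := fun m => Sum.inr ⟨Sum.inr m, hnew m⟩
  have hplace : ∀ m, ρ.place g g.root φ (Sum.inr m) = c m := fun m => dif_neg (hnew m)
  let G := (ρ.build g g.root φ).redirect (Sum.inl g.root) (ρ.place g g.root φ ρ.r)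
  have hsuc : ∀ m, (b.suc m).map c = G.suc (c m) := by
    intro m
    have h1 : (((b.suc m).map Sum.inr).map (ρ.place g g.root φ)).map
        (redirect (Sum.inl g.root) (ρ.place g g.root φ ρ.r)) = (b.suc m).map c := by
      refine ((congrArg _ List.map_map).trans List.map_map).trans
        (List.map_congr_left fun k _ => ?_)
      exact (congrArg _ (hplace k)).trans (if_neg Sum.inr_ne_inl)
    exact h1.symm
  have hroot : redirect (Sum.inl g.root) (ρ.place g g.root φ ρ.r) (Sum.inl g.root) = c b.root :=
    (if_pos rfl).trans (hplace b.root)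
  have hreach : ∀ m, Reach G.suc
      (redirect (Sum.inl g.root) (ρ.place g g.root φ ρ.r) (Sum.inl g.root)) (c m) := by
    intro m
    obtain ⟨π, hπ⟩ := b.reachable m
    rw [hroot]
    exact ⟨π, hπ.map hsuc⟩
  refine (canon_eq_of_isHom_injective (φ := fun m => ⟨c m, hreach m⟩)
    ⟨Subtype.ext hroot.symm, fun m _ => ?_, fun m _ => ?_⟩ fun m m' h => ?_).symm
  · exact Sum.inl_injective (ρ.funSym_newLab ⟨Sum.inr m, hnew m⟩).symm
  · refine List.map_injective_iff.2 Subtype.val_injective ?_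
    rw [List.map_map]
    exact (hsuc m).trans (List.attachWith_map_subtype_val _).symm
  · have h1 : c m = c m' := congrArg Subtype.val h
    exact Sum.inr_injective (congrArg Subtype.val (Sum.inr_injective h1))

theorem step_disjointRule {Sg : Signature.{u}} (V : Type w) {N M : Type v} {K : Type}
    {a : TermGraph Sg N} {g : TermGraph Sg K} {ψ : N → K} (hψ : IsHom ∅ a g ψ)
    (b : TermGraph Sg M) :
    (disjointRule V a b).Step (canon g) (canon g).graph.root (canon b) := by
  -- Nodes of the right-hand side are not reachable from the left one; `g.root` is a dummy value.
  refine ⟨K, g, g.root, fun m => ⟨Sum.elim ψ (fun _ => g.root) m.1, g.reachable _⟩, ⟨?_, ?_, ?_⟩,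
    rfl, canon_contract_disjointRule V a b g _, rfl⟩
  · exact Subtype.ext hψ.map_root
  · rintro ⟨m | m, hm⟩ -
    · exact congrArg Sum.inl (hψ.labelling m id)
    · exact absurd hm (not_reach_disjointRule_inr V a b m)
  · rintro ⟨m | m, hm⟩ -
    · refine List.map_injective_iff.2 Subtype.val_injective ?_
      rw [List.map_map]
      refine Eq.trans ?_ ((hψ.successor m id).trans (List.attachWith_map_subtype_val _).symm)
      have h1 : ((disjointRule V a b).lhs.suc ⟨Sum.inl m, hm⟩).map Subtype.val =
          (a.suc m).map Sum.inl := List.attachWith_map_subtype_val _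
      have h2 := congrArg (List.map (Sum.elim ψ fun _ => g.root)) h1
      exact (List.map_map.symm.trans h2).trans List.map_map
    · exact absurd hm (not_reach_disjointRule_inr V a b m)

/-! ### The alternating reduction -/

theorem isHom_fcTree_fcShared : IsHom ∅ fcTree fcShared ![0, 1, 1] where
  map_root := rfl
  labelling := fun n _ => by fin_cases n <;> rfl
  successor := fun n _ => by fin_cases n <;> rfl

open Classical in
/-- The alternating sequence: at odd finite ordinals the shared `f(c, c)`, elsewhere the tree. -/
noncomputable def fcGraph (ι : Ordinal.{y}) : CanTermGraph fcSig :=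
  if ∃ k : ℕ, ι = ((2 * k + 1 : ℕ) : Ordinal.{y}) then canon fcShared else canon fcTree

/-- The sequence of steps at the root between the term graphs `fcGraph ι`, of length `ω`. -/
noncomputable def fcSeq : StepSeq.{0, y} fcSig where
  len := Ordinal.omega0
  graph := fcGraph
  node := fun ι => (fcGraph ι).graph.root

theorem fcGraph_even (k : ℕ) :
    fcGraph ((2 * k : ℕ) : Ordinal.{y}) = canon fcTree := by
  refine if_neg ?_
  rintro ⟨j, hj⟩
  have := Nat.cast_injective hj
  omega

theorem fcGraph_odd (k : ℕ) :
    fcGraph ((2 * k + 1 : ℕ) : Ordinal.{y}) = canon fcShared :=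
  if_pos ⟨k, rfl⟩

theorem isReduction_fcSeq (V : Type w) : IsReduction (fcGRS V) fcSeq.{y} := by
  intro ι hι
  obtain ⟨n, rfl⟩ := Ordinal.lt_omega0.1 (show ι < Ordinal.omega0 from hι)
  change (fcGRS V).Step (fcGraph n) (fcGraph n).graph.root (fcGraph ((n + 1 : ℕ) : Ordinal.{y}))
  obtain ⟨k, rfl | rfl⟩ := n.even_or_odd'
  · rw [fcGraph_odd, fcGraph_even]
    exact ⟨_, Or.inr rfl, step_disjointRule V (IsHom.id fcTree ∅) fcShared⟩
  · rw [show 2 * k + 1 + 1 = 2 * (k + 1) by omega, fcGraph_odd, fcGraph_even]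
    exact ⟨_, Or.inl rfl, step_disjointRule V isHom_fcTree_fcShared fcTree⟩

/-- The tree is the least element of every tail, hence each greatest lower bound. -/
theorem isLiminf_fcSeq :
    IsLiminf Ordinal.omega0 fcSeq.{y}.toBot.graph (canon fcTree).toBot := by
  refine ⟨fun _ => (canon fcTree).toBot, fun β hβ => ⟨?_, fun c hc => ?_⟩, ?_, fun c hc => ?_⟩
  · rintro _ ⟨ι, -, rfl⟩
    change _ ≤ (fcGraph ι).toBot
    unfold fcGraph
    split_ifs
    · rw [← canon_toBot, canon_le_iff]
      have h : IsHom ∅ fcTree.toBot fcShared.toBot ![0, 1, 1] :=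
        ⟨rfl, fun n _ => congrArg some (isHom_fcTree_fcShared.labelling n id),
          fun n _ => isHom_fcTree_fcShared.successor n id⟩
      exact ⟨_, ((isHom_canon fcShared.toBot).comp h).of_empty _⟩
    · exact CanTermGraph.le_refl _
  · obtain ⟨n, rfl⟩ := Ordinal.lt_omega0.1 hβ
    refine hc ⟨((2 * n : ℕ) : Ordinal.{y}), ⟨Nat.cast_le.2 (by omega),
      Ordinal.natCast_lt_omega0 _⟩, ?_⟩
    exact congrArg CanTermGraph.toBot (fcGraph_even n)
  · rintro _ ⟨ι, -, rfl⟩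
    exact CanTermGraph.le_refl _
  · exact hc ⟨0, Ordinal.omega0_pos, rfl⟩

theorem seqLength_omega0 : seqLength Ordinal.omega0.{y} = Ordinal.omega0 :=
  if_pos Ordinal.isSuccLimit_omega0

theorem weaklyPConverges_fcSeq (V : Type w) :
    WeaklyPConverges (fcGRS V) fcSeq.{y}.toBot (canon fcTree).toBot (canon fcTree).toBot := by
  refine ⟨?_, ⟨(isReduction_fcSeq V).toBot, fun o ho ho' => ?_⟩, ?_⟩
  · have h := fcGraph_even.{y} 0
    rw [Nat.mul_zero, Nat.cast_zero] at h
    exact congrArg CanTermGraph.toBot h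
  · exact absurd (Ordinal.omega0_le_of_isSuccLimit ho') (show o < Ordinal.omega0 from ho).not_ge
  · change IsLiminf (seqLength Ordinal.omega0) fcSeq.toBot.graph _
    rw [seqLength_omega0]
    exact isLiminf_fcSeq

/-- A limit would share the positions `0` and `1`, like the terms with odd index, and so would the
terms with even index. -/
theorem not_isLim_fcSeq (h : CanTermGraph fcSig) :
    ¬ IsLim Ordinal.omega0 fcGraph.{y} h := by
  intro H
  obtain ⟨β, hβ, hι⟩ := H ((2 : ℝ)⁻¹ ^ 1) (by positivity)
  obtain ⟨n, rfl⟩ := Ordinal.lt_omega0.1 hβ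
  have h1 := hι ((2 * n : ℕ) : Ordinal.{y}) (Nat.cast_le.2 (by omega))
    (Ordinal.natCast_lt_omega0 _)
  have h2 := hι ((2 * n + 1 : ℕ) : Ordinal.{y}) (Nat.cast_le.2 (by omega))
    (Ordinal.natCast_lt_omega0 _)
  rw [fcGraph_even] at h1
  rw [fcGraph_odd] at h2
  obtain ⟨-, φ, hφ⟩ := exists_isHom_trunc_of_sdist_lt h1
  obtain ⟨⟨ψ, hψ⟩, -⟩ := exists_isHom_trunc_of_sdist_lt h2
  have hs : ∀ i < 2, IsPath fcShared.suc fcShared.root [i] 1 := by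
    intro i hi
    interval_cases i <;> exact ⟨1, rfl, rfl⟩
  obtain ⟨m, hm, hm'⟩ := hψ.exists_path_of_trunc (π := [0]) (π' := [1])
    ((isHom_canon fcShared).path (hs 0 (by norm_num)))
    ((isHom_canon fcShared).path (hs 1 (by norm_num))) le_rfl le_rfl
  obtain ⟨k, hk, hk'⟩ := hφ.exists_path_of_trunc hm hm' le_rfl le_rfl
  have hk0 := (isHom_canon_symm fcTree).path hk
  have hk1 := (isHom_canon_symm fcTree).path hk'
  have e0 := hk0.unique (k := 1) ⟨1, rfl, rfl⟩
  have e1 := hk1.unique (k := 2) ⟨2, rfl, rfl⟩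
  exact absurd (e0.symm.trans e1) (by decide)

end TermGraphRewriting

theorem mainTheorem9 (V : Type w) :
    -- Weak m-convergence implies weak p-convergence.
    (∀ (Sg : Signature.{u}) (R : GRS.{u, v} Sg V) (S : StepSeq.{u, y} Sg)
      (g h : CanTermGraph Sg),
      WeaklyMConverges R S g h → WeaklyPConverges R S.toBot g.toBot h.toBot) ∧
    -- The converse fails: the alternating reduction of length `ω` between the tree `f(c, c)` and
    -- its shared version is weakly p-convergent to the tree, but not weakly m-convergent.
    (∃ S : StepSeq.{0, y} fcSig,
      S.len = Ordinal.omega0 ∧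
      (∀ k : ℕ, S.graph ((2 * k : ℕ) : Ordinal.{y}) = canon fcTree ∧
        S.graph ((2 * k + 1 : ℕ) : Ordinal.{y}) = canon fcShared) ∧
      IsReduction (fcGRS V) S ∧
      WeaklyPConverges (fcGRS V) S.toBot (canon fcTree).toBot (canon fcTree).toBot ∧
      ∀ g h : CanTermGraph fcSig, ¬ WeaklyMConverges (fcGRS V) S g h) := by
  refine ⟨fun Sg R S g h H => H.toBot, fcSeq, rfl,
    fun k => ⟨fcGraph_even k, fcGraph_odd k⟩, isReduction_fcSeq V,
    weaklyPConverges_fcSeq V, ?_⟩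
  rintro g h ⟨-, -, hl⟩
  have hl' : IsLim (seqLength Ordinal.omega0) fcGraph h := hl
  rw [seqLength_omega0] at hl'
  exact not_isLim_fcSeq h hl'
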